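/- **Theorem (Convergence).** Let $\mathcal G=(\mathcal V,\mathcal E)$ be a finite directed graph, $\mathcal N_i=\{v_j:(v_j,v_i)\in\mathcal E\}$ the set of in-neighbors of $v_i$, $F\ge 1$ an integer, and let $\mathcal A\subset\mathcal V$ be a set of Byzantine nodes that is $F$-local, i.e. $|\mathcal N_i\cap\mathcal A|\le F$ for every regular node $v_i\in\mathcal R=\mathcal V\setminus\mathcal A$. A set $S$ of nodes is $r$-reachable if some $v_i\in S$ has $|\mathcal N_i\setminus S|\ge r$, and $\mathcal G$ is $r$-robust if of any two disjoint nonempty sets of nodes at least one is $r$-reachable. Let $f_i:\mathbb R^d\to\mathbb R$ $(v_i\in\mathcal V)$ be convex, with nonempty bounded $\operatorname{argmin} f_i$, and let $L>0$ be such that $\|g\|\le L$ for all $x$, all $v_i\in\mathcal V$ and all $g\in\partial f_i(x)$. Let $x_i^*\in\operatorname{argmin} f_i$ be arbitrary, let $\hat x_i^*$ satisfy $\|\hat x_i^*-x_i^*\|\le\epsilon^*$ for $v_i\in\mathcal R$ and some $\epsilon^*\ge0$, and let $\eta[k]=c_1/(k+c_2)$ with $c_1,c_2>0$. *Algorithms.*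 Every regular node $v_i$ starts with $x_i[0]=y_i[0]=\hat x_i^*$. At each time $k\in\mathbb N$ it receives $x_j[k],y_j[k]\in\mathbb R^d$ from every $v_j\in\mathcal N_i$; regular nodes send their true values, Byzantine nodes send arbitrary values, possibly different ones to different nodes. Among given real values of the nodes in $\mathcal N_i\cup\{v_i\}$ (or a subset containing $v_i$), "removing the $F$ largest (smallest) values" means: removing the $F$ largest (smallest) of the values that are strictly larger (smaller) than $v_i$'s own value, or all of these if there are fewer than $F$, with ties broken arbitrarily. Node $v_i$ performs: 1. Distance filter: it removes the nodes with the $F$ largest values of $\|x_j[k]-y_i[k]\|$, $v_j\in\mathcal N_i\cup\{v_i\}$; let $\mathcal V_i^{\rm dist}[k]$ be the remaining set. 2. Only in Algorithm 1 (min-max filter): for every coordinate $\ell$ it determines the nodes with the $F$ largest and the $F$ smallest values $x_j^{(\ell)}[k]$ among $v_j\in\mathcal V_i^{\rm dist}[k]$, and removes every node so determined for at least one $\ell$. Let $\mathcal S_i[k]$ be the remaining set. In Algorithm 2, $\mathcal S_i[k]=\mathcal V_i^{\rm dist}[k]$. 3. $z_i[k]=\sum_{v_j\in\mathcal S_i[k]}w_{x,ij}[k]\,x_j[k]$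 and $x_i[k+1]=z_i[k]-\eta[k]g_i[k]$ with $g_i[k]\in\partial f_i(z_i[k])$. 4. For every coordinate $\ell$ it removes the $F$ largest and the $F$ smallest values $y_j^{(\ell)}[k]$, $v_j\in\mathcal N_i\cup\{v_i\}$, and sets $y_i^{(\ell)}[k+1]=\sum w^{(\ell)}_{y,ij}[k]\,y_j^{(\ell)}[k]$, summed over the remaining nodes. In each average the weights sum to one, they are positive exactly on the retained nodes, and there is a constant $\omega>0$ that bounds all nonzero weights from below. Suppose that $\mathcal G$ is $((2d+1)F+1)$-robust if the regular nodes follow Algorithm 1, and $(2F+1)$-robust if they follow Algorithm 2. Then: (a) For all $v_i\in\mathcal R$ and $\epsilon>0$, with $\mathcal C_i(\epsilon)=\{x: f_i(x)\le f_i(x_i^*)+\epsilon\}$, there exist $\delta_i(\epsilon)\in(0,\infty)$ with $\mathcal C_i(\epsilon)\subseteq\{x:\|x-x_i^*\|\le\delta_i(\epsilon)\}$, and $\theta_i(\epsilon)\in[0,\pi/2)$ with $\angle(-g,x_i^*-x)\le\theta_i(\epsilon)$ for all $x\notin\mathcal C_i(\epsilon)$ and $g\in\partial f_i(x)$. (b)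 There is a point $y[\infty]\in\mathbb R^d$ with $y_i[k]\to y[\infty]$ for all $v_i\in\mathcal R$. (c) With $\tilde R_i=\|x_i^*-y[\infty]\|$ and, for any choice of $\delta_i(\epsilon)$ and $\theta_i(\epsilon)$ as in (a), $$s^*(\xi,\epsilon)=\max_{v_i\in\mathcal R}\max\{\tilde R_i\sec\theta_i(\epsilon),\ \tilde R_i+\delta_i(\epsilon)\}+\xi ,$$ we have, regardless of the actions of the Byzantine nodes, for every $v_i\in\mathcal R$, $$\limsup_{k\to\infty}\|x_i[k]-y[\infty]\|\le\inf_{\epsilon>0}s^*(0,\epsilon).$$ -/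

import Mathlib

open Filter Topology

namespace ResilientOpt

/-- The decision space `ℝ^d` with its Euclidean norm. -/
abbrev Vec (d : ℕ) : Type := EuclideanSpace ℝ (Fin d)

/-! ### Directed graphs, robustness, local adversaries -/

section Graph

variable {V : Type*} [Fintype V]

open Classical in
/-- In-neighbours of `i`: `G.Adj j i` says that `i` can receive information from `j`. -/
noncomputable def inNeighbors (G : Digraph V) (i : V) : Finset V :=
  Finset.univ.filter fun j => G.Adj j i

variable [DecidableEq V]

/-- `S` is `r`-reachable: some node of `S` has at least `r` in-neighbours outside `S`. -/
def IsReachable (G : Digraph V) (r : ℕ) (S : Finset V) : Prop :=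
  ∃ i ∈ S, r ≤ (inNeighbors G i \ S).card

/-- `G` is `r`-robust: of any two disjoint nonempty sets of nodes, at least one is `r`-reachable. -/
def IsRobust (G : Digraph V) (r : ℕ) : Prop :=
  ∀ S₁ S₂ : Finset V, S₁.Nonempty → S₂.Nonempty → Disjoint S₁ S₂ →
    IsReachable G r S₁ ∨ IsReachable G r S₂

/-- The set of adversaries `A` is `F`-local: every regular node has at most `F` in-neighbours
in `A`. -/
def IsLocalSet (G : Digraph V) (F : ℕ) (A : Finset V) : Prop :=
  ∀ i, i ∉ A → (inNeighbors G i ∩ A).card ≤ F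

/-- The nodes whose values node `i` possesses after communication: its in-neighbours and itself. -/
noncomputable def senders (G : Digraph V) (i : V) : Finset V :=
  insert i (inNeighbors G i)

end Graph

/-! ### Convex functions -/

section Functions

variable {d : ℕ}

/-- The set of global minimizers. -/
def argminSet (f : Vec d → ℝ) : Set (Vec d) := {x | ∀ u, f x ≤ f u}

/-- The subdifferential `∂f(x)`. -/
def subdifferential (f : Vec d → ℝ) (x : Vec d) : Set (Vec d) :=
  {g | ∀ u, f x + inner ℝ g (u - x) ≤ f u}

/-- The sublevel set `C(ε) = {x : f x ≤ f x* + ε}`. -/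
def sublevelSet (f : Vec d → ℝ) (xstar : Vec d) (ε : ℝ) : Set (Vec d) :=
  {x | f x ≤ f xstar + ε}

/-- `δ ∈ (0, ∞)` is a radius with `C(ε) ⊆ B(x*, δ)`. -/
def IsSublevelRadius (f : Vec d → ℝ) (xstar : Vec d) (ε δ : ℝ) : Prop :=
  0 < δ ∧ sublevelSet f xstar ε ⊆ Metric.closedBall xstar δ

/-- `θ ∈ [0, π/2)` bounds the angle between `-g` and `x* - x` for all `x ∉ C(ε)` and
all `g ∈ ∂f(x)`. -/
def IsAngleBound (f : Vec d → ℝ) (xstar : Vec d) (ε θ : ℝ) : Prop :=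
  0 ≤ θ ∧ θ < Real.pi / 2 ∧
    ∀ x, x ∉ sublevelSet f xstar ε → ∀ g ∈ subdifferential f x,
      InnerProductGeometry.angle (-g) (xstar - x) ≤ θ

end Functions

/-! ### Filters and weights -/

section Filters

variable {V : Type*} [DecidableEq V]

/-- `T` is a set of nodes that node `i` may discard when, among the values `a j`, `j ∈ D`, it removes
the `F` largest ones that are larger than its own value `a i`, or all larger ones if there are fewer
than `F` of them. Ties are broken arbitrarily, so several `T` may qualify. -/
def IsTopRemoval (F : ℕ) (i : V) (D : Finset V) (a : V → ℝ) (T : Finset V) : Prop :=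
  T ⊆ D.filter (fun j => a i < a j) ∧
    T.card = min F (D.filter fun j => a i < a j).card ∧
    ∀ s ∈ T, ∀ t ∈ D.filter (fun j => a i < a j) \ T, a t ≤ a s

/-- The same with the `F` smallest values that are smaller than the own value. -/
def IsBottomRemoval (F : ℕ) (i : V) (D : Finset V) (a : V → ℝ) (T : Finset V) : Prop :=
  IsTopRemoval F i D (fun j => -a j) T

/-- Distance filter: `S` is what is left of `D` when node `i` compares the distances of the vectors
`X j` to its auxiliary point `yi`. -/
def DistFilter {d : ℕ} (F : ℕ) (i : V) (yi : Vec d) (D : Finset V) (X : V → Vec d)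
    (S : Finset V) : Prop :=
  ∃ T, IsTopRemoval F i D (fun j => ‖X j - yi‖) T ∧ S = D \ T

/-- Min-max filter on whole states: a node is discarded as soon as one of its components is discarded
as an extreme value among the vectors `X j`, `j ∈ D`. -/
def StateMinMaxFilter {d : ℕ} (F : ℕ) (i : V) (D : Finset V) (X : V → Vec d)
    (S : Finset V) : Prop :=
  ∃ T B : Fin d → Finset V,
    (∀ l, IsTopRemoval F i D (fun j => X j l) (T l)) ∧
    (∀ l, IsBottomRemoval F i D (fun j => X j l) (B l)) ∧
    S = D \ Finset.univ.biUnion (fun l => T l ∪ B l)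

/-- Min-max filter on scalars, used for one component of the auxiliary points. -/
def ScalarMinMaxFilter (F : ℕ) (i : V) (D : Finset V) (a : V → ℝ) (S : Finset V) : Prop :=
  ∃ T B : Finset V, IsTopRemoval F i D a T ∧ IsBottomRemoval F i D a B ∧ S = D \ (T ∪ B)

/-- Averaging weights on the retained set `S`: they sum to one, they are positive exactly on `S`,
and the nonzero ones are at least `ω`. -/
def IsWeights (ω : ℝ) (S : Finset V) (w : V → ℝ) : Prop :=
  (∀ j, 0 < w j ↔ j ∈ S) ∧ (∀ j, w j ≠ 0 → ω ≤ w j) ∧ ∑ j ∈ S, w j = 1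

end Filters

/-! ### The algorithms -/

/-- The two algorithms. -/
inductive Alg
  /-- Simultaneous Distance-MinMax Filtering Dynamics. -/
  | distMinMax
  /-- Simultaneous Distance Filtering Dynamics. -/
  | distOnly

/-- All quantities that occur in an execution. Time comes first, then the node that computes or
receives, then (for messages and weights) the node that the value comes from. -/
structure Execution (V : Type*) (d : ℕ) where
  /-- state `x_i[k]` -/
  x : ℕ → V → Vec d
  /-- estimated auxiliary point `y_i[k]` -/
  y : ℕ → V → Vec d
  /-- `xmsg k i j`: the state received by `i` from `j` -/
  xmsg : ℕ → V → V → Vec d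
  /-- `ymsg k i j`: the auxiliary point received by `i` from `j` -/
  ymsg : ℕ → V → V → Vec d
  /-- nodes retained after the distance filter -/
  distKept : ℕ → V → Finset V
  /-- nodes whose states enter the weighted average -/
  kept : ℕ → V → Finset V
  /-- nodes retained by the filter on the component `l` of the auxiliary points -/
  yKept : ℕ → V → Fin d → Finset V
  /-- weights for the states -/
  wx : ℕ → V → V → ℝ
  /-- weights for the component `l` of the auxiliary points -/
  wy : ℕ → V → Fin d → V → ℝ
  /-- intermediate state `z_i[k]` -/
  z : ℕ → V → Vec d
  /-- subgradient `g_i[k]` -/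
  g : ℕ → V → Vec d

section Run

variable {V : Type*} [Fintype V] [DecidableEq V] {d : ℕ}

/-- The regular node `i` (that is, `i ∉ A`) carries out iteration `k` of the algorithm `alg`.
Values from regular nodes are received truthfully; nothing is required of values received from
nodes of `A`, which may differ from receiver to receiver. -/
structure RegularStep (alg : Alg) (G : Digraph V) (A : Finset V) (F : ℕ) (f : V → Vec d → ℝ)
    (η : ℕ → ℝ) (ω : ℝ) (e : Execution V d) (k : ℕ) (i : V) : Prop where
  receive_x : ∀ j ∈ senders G i, j ∉ A → e.xmsg k i j = e.x k j
  receive_y : ∀ j ∈ senders G i, j ∉ A → e.ymsg k i j = e.y k j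
  dist_filter : DistFilter F i (e.y k i) (senders G i) (e.xmsg k i) (e.distKept k i)
  state_filter : match alg with
    | .distMinMax => StateMinMaxFilter F i (e.distKept k i) (e.xmsg k i) (e.kept k i)
    | .distOnly => e.kept k i = e.distKept k i
  x_weights : IsWeights ω (e.kept k i) (e.wx k i)
  x_average : e.z k i = ∑ j ∈ e.kept k i, e.wx k i j • e.xmsg k i j
  subgradient : e.g k i ∈ subdifferential (f i) (e.z k i)
  gradient_update : e.x (k + 1) i = e.z k i - η k • e.g k i
  aux_filter : ∀ l, ScalarMinMaxFilter F i (senders G i) (fun j => e.ymsg k i j l) (e.yKept k i l)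
  y_weights : ∀ l, IsWeights ω (e.yKept k i l) (e.wy k i l)
  y_average : ∀ l, e.y (k + 1) i l = ∑ j ∈ e.yKept k i l, e.wy k i l j * e.ymsg k i j l

/-- The regular nodes follow the algorithm `alg`, starting from the approximate minimizers `xhat`.
Nodes of `A` are unconstrained. -/
structure Follows (alg : Alg) (G : Digraph V) (A : Finset V) (F : ℕ) (f : V → Vec d → ℝ)
    (xhat : V → Vec d) (η : ℕ → ℝ) (ω : ℝ) (e : Execution V d) : Prop where
  init_x : ∀ i, i ∉ A → e.x 0 i = xhat i
  init_y : ∀ i, i ∉ A → e.y 0 i = xhat i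
  step : ∀ k i, i ∉ A → RegularStep alg G A F f η ω e k i

/-- The convergence radius
`s*(ξ, ε) = max_{i regular} max {R̃_i sec θ_i(ε), R̃_i + δ_i(ε)} + ξ` with `R̃_i = ‖x_i* - y[∞]‖`.
The regular nodes are those of `Aᶜ`. -/
noncomputable def convRadius (A : Finset V) (hA : Aᶜ.Nonempty) (xstar : V → Vec d) (yinf : Vec d)
    (θ δ : V → ℝ → ℝ) (ξ ε : ℝ) : ℝ :=
  Aᶜ.sup' hA (fun i => max (‖xstar i - yinf‖ * (Real.cos (θ i ε))⁻¹)
    (‖xstar i - yinf‖ + δ i ε)) + ξ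

end Run

end ResilientOpt

/-! The auxiliary points evolve without reference to the states: each coordinate runs a trimmed-mean
consensus. Robustness shrinks the spread of the regular values by a fixed factor every fixed number
of steps (`TrimmedMeanDynamics.contraction`), so they converge to a common point y and, crucially,
their errors are summable (`TrimmedMeanDynamics.exists_limit`).

Let D[k] be the largest distance of a regular state to y. Since a regular node hears at most F
adversaries, whatever survives its distance filter is no farther from y_i than some regular state;
averaging therefore exceeds D[k] by at most 2‖y_i - y‖ (`RegularStep.norm_z_sub_le`). A min-max
filter on states only discards further nodes, so both algorithms share this bound.

Fix s above the convergence radius. If z is at distance at least s from y, the negative subgradient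
makes an angle with y - z bounded away from a right angle, and a small step η brings z closer by at
least cη (`exists_gradient_step_decrease`); otherwise z moves by at most ηL. Hence D[k+1] ≤ max(s +
ηL, D[k] + E[k] - cη) with E summable, η not summable and η → 0, which forces D below s + ξ
eventually (`eventually_le_of_decrease`). -/

namespace ResilientOpt

/-! ### Convex geometry: growth, angles and the decrease of a subgradient step. -/

section Convexity

variable {d : ℕ} {f : Vec d → ℝ} {xs : Vec d}

theorem convex_lineMap_le (hf : ConvexOn ℝ Set.univ f) (x : Vec d) {t : ℝ} (h0 : 0 ≤ t)
    (h1 : t ≤ 1) : f (xs + t • (x - xs)) ≤ f xs + t * (f x - f xs) := by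
  have h := hf.2 (Set.mem_univ xs) (Set.mem_univ x) (sub_nonneg.2 h1) h0 (by ring)
  have e : (1 - t) • xs + t • x = xs + t • (x - xs) := by module
  rw [e] at h
  simp only [smul_eq_mul] at h
  linarith

/-- By compactness `f` exceeds its minimum by some μ > 0 on a sphere of radius r enclosing the
minimizers; by convexity it then grows along rays with slope at least μ / r beyond that sphere. -/
theorem exists_isSublevelRadius (hf : ConvexOn ℝ Set.univ f)
    (hb : Bornology.IsBounded (argminSet f)) (hxs : xs ∈ argminSet f) (ε : ℝ) :
    ∃ δ, IsSublevelRadius f xs ε δ := by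
  have hcont : ContinuousOn f Set.univ := hf.continuousOn isOpen_univ
  obtain ⟨r, hr0, hr⟩ := hb.subset_ball_lt 0 xs
  have hgap : ∃ μ, 0 < μ ∧ ∀ p ∈ Metric.sphere xs r, f xs + μ ≤ f p := by
    rcases (Metric.sphere xs r).eq_empty_or_nonempty with h | h
    -- The sphere is empty when d = 0.
    · exact ⟨1, one_pos, by simp [h]⟩
    · obtain ⟨p, hp, hmin⟩ := (isCompact_sphere xs r).exists_isMinOn h
        (hcont.mono (Set.subset_univ _))
      refine ⟨f p - f xs, ?_, fun q hq => ?_⟩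
      · by_contra hcon
        have hmem : p ∈ argminSet f := fun u => by linarith [hxs u]
        have := hr hmem
        simp only [Metric.mem_ball, Metric.mem_sphere] at this hp
        linarith
      · have : f p ≤ f q := hmin hq
        linarith
  obtain ⟨μ, hμ, hsph⟩ := hgap
  refine ⟨max r (ε * r / μ), lt_max_of_lt_left hr0, fun x hx => ?_⟩
  have hx' : f x ≤ f xs + ε := hx
  rw [Metric.mem_closedBall, dist_eq_norm]
  rcases le_or_gt ‖x - xs‖ r with h | h
  · exact h.trans (le_max_left _ _)
  · refine le_trans ?_ (le_max_right _ _)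
    have hn : 0 < ‖x - xs‖ := hr0.trans h
    have h1 := convex_lineMap_le (xs := xs) hf x (t := r / ‖x - xs‖) (by positivity)
      ((div_le_one hn).2 h.le)
    have h2 := hsph (xs + (r / ‖x - xs‖) • (x - xs)) (by
      rw [mem_sphere_iff_norm, add_sub_cancel_left, norm_smul, Real.norm_of_nonneg (by positivity),
        div_mul_cancel₀ _ hn.ne'])
    have h3 : μ ≤ r / ‖x - xs‖ * ε :=
      (by linarith : μ ≤ r / ‖x - xs‖ * (f x - f xs)).trans
        (mul_le_mul_of_nonneg_left (by linarith) (by positivity))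
    rw [le_div_iff₀ hμ]
    calc ‖x - xs‖ * μ ≤ ‖x - xs‖ * (r / ‖x - xs‖ * ε) := by gcongr
      _ = ε * r := by field_simp

/-- Contracting x towards `xs` by the factor ε / (f x - f xs) lands in the sublevel set by
convexity, hence within δ of `xs`. -/
theorem linear_growth (hf : ConvexOn ℝ Set.univ f) {ε δ : ℝ} (hε : 0 < ε)
    (hδ : IsSublevelRadius f xs ε δ) {x : Vec d} (hx : x ∉ sublevelSet f xs ε) :
    ε / δ * ‖x - xs‖ ≤ f x - f xs := by
  have hx' : ε < f x - f xs := by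
    have : ¬ f x ≤ f xs + ε := hx
    linarith
  have hpos : 0 < f x - f xs := hε.trans hx'
  have h1 := convex_lineMap_le (xs := xs) hf x (t := ε / (f x - f xs)) (by positivity)
    ((div_le_one hpos).2 hx'.le)
  rw [div_mul_cancel₀ _ hpos.ne'] at h1
  have h2 := hδ.2 h1
  rw [mem_closedBall_iff_norm, add_sub_cancel_left, norm_smul,
    Real.norm_of_nonneg (by positivity), div_mul_eq_mul_div, div_le_iff₀ hpos] at h2
  rw [div_mul_eq_mul_div, div_le_iff₀ hδ.1]
  linarith

theorem inner_subgradient_ge {x g : Vec d} (hg : g ∈ subdifferential f x) :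
    f x - f xs ≤ inner ℝ g (x - xs) := by
  have h := hg xs
  rw [← neg_sub, inner_neg_right] at h
  linarith

theorem ne_of_notMem_sublevelSet {ε : ℝ} (hε : 0 < ε) {x : Vec d}
    (hx : x ∉ sublevelSet f xs ε) : 0 < ‖x - xs‖ := by
  rw [norm_pos_iff, sub_ne_zero]
  rintro rfl
  exact hx (by simp [sublevelSet, hε.le])

theorem norm_subgradient_ge (hf : ConvexOn ℝ Set.univ f) {ε δ : ℝ} (hε : 0 < ε)
    (hδ : IsSublevelRadius f xs ε δ) {x g : Vec d} (hx : x ∉ sublevelSet f xs ε)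
    (hg : g ∈ subdifferential f x) : ε / δ ≤ ‖g‖ := by
  have h1 := (linear_growth hf hε hδ hx).trans
    ((inner_subgradient_ge hg).trans (real_inner_le_norm _ _))
  exact le_of_mul_le_mul_right h1 (ne_of_notMem_sublevelSet hε hx)

/-- Linear growth bounds the inner product of g with x - xs below by (ε / δ)‖x - xs‖, and ‖g‖ ≤ L,
so the cosine of the angle is at least ε / (δL). -/
theorem exists_isAngleBound (hf : ConvexOn ℝ Set.univ f) {ε δ : ℝ} (hε : 0 < ε)
    (hδ : IsSublevelRadius f xs ε δ) {L : ℝ} (hL : 0 < L)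
    (hgrad : ∀ x, ∀ g ∈ subdifferential f x, ‖g‖ ≤ L) :
    ∃ θ, IsAngleBound f xs ε θ := by
  have hδ0 := hδ.1
  refine ⟨Real.arccos (ε / δ / L), Real.arccos_nonneg _,
    Real.arccos_lt_pi_div_two.2 (by positivity), fun x hx g hg => ?_⟩
  have hn := ne_of_notMem_sublevelSet hε hx
  have hgL := hgrad x g hg
  have hg0 : 0 < ‖g‖ := lt_of_lt_of_le (by positivity) (norm_subgradient_ge hf hε hδ hx hg)
  rw [InnerProductGeometry.angle]
  apply Real.arccos_le_arccos
  rw [← neg_sub x xs, inner_neg_neg, norm_neg, norm_neg, div_div,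
    div_le_div_iff₀ (by positivity) (by positivity)]
  have h1 := (linear_growth hf hε hδ hx).trans (inner_subgradient_ge hg)
  rw [div_mul_eq_mul_div, div_le_iff₀ hδ0] at h1
  calc ε * (‖g‖ * ‖x - xs‖) = (ε * ‖x - xs‖) * ‖g‖ := by ring
    _ ≤ (inner ℝ g (x - xs) * δ) * ‖g‖ := by gcongr
    _ ≤ (inner ℝ g (x - xs) * δ) * L := by
        have : 0 ≤ inner ℝ g (x - xs) * δ := le_trans (by positivity) h1
        gcongr
    _ = _ := by ring

/-- The distance from the endpoint of `b` to the line spanned by `a` is at most `‖a - b‖`. -/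
theorem sin_angle_mul_norm_le (a b : Vec d) (ha : a ≠ 0) :
    Real.sin (InnerProductGeometry.angle a b) * ‖b‖ ≤ ‖a - b‖ := by
  have ha' : 0 < ‖a‖ := norm_pos_iff.2 ha
  have hs := InnerProductGeometry.sin_angle_nonneg a b
  have hsq : (Real.sin (InnerProductGeometry.angle a b) * ‖b‖) ^ 2 ≤ ‖a - b‖ ^ 2 := by
    have h1 := InnerProductGeometry.cos_angle_mul_norm_mul_norm a b
    have h2 := Real.sin_sq_add_cos_sq (InnerProductGeometry.angle a b)
    rw [@norm_sub_sq_real, ← h1]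
    nlinarith [sq_nonneg (‖a‖ - Real.cos (InnerProductGeometry.angle a b) * ‖b‖)]
  exact abs_le_of_sq_le_sq' hsq (norm_nonneg _) |>.2

/-- Outside the convergence radius the negative subgradient points towards `y`, at an angle
bounded away from a right angle. -/
theorem exists_inner_subgradient_ge (hf : ConvexOn ℝ Set.univ f) {ε δ θ : ℝ} (hε : 0 < ε)
    (hδ : IsSublevelRadius f xs ε δ) (hθ : IsAngleBound f xs ε θ) (y : Vec d) {s : ℝ}
    (hs₁ : ‖xs - y‖ * (Real.cos θ)⁻¹ < s) (hs₂ : ‖xs - y‖ + δ < s) :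
    ∃ c, 0 < c ∧ ∀ z, s ≤ ‖z - y‖ → ∀ g ∈ subdifferential f z,
      c * ‖z - y‖ ≤ inner ℝ g (z - y) := by
  obtain ⟨hθ0, hθ1, hang⟩ := hθ
  have hδ0 := hδ.1
  have hcos : 0 < Real.cos θ := Real.cos_pos_of_mem_Ioo ⟨by linarith, hθ1⟩
  set R := ‖xs - y‖ with hR
  have hR0 : 0 ≤ R := norm_nonneg _
  have hs : 0 < s := by linarith
  have hq0 : 0 ≤ R / s := by positivity
  have hq1 : R / s < Real.cos θ := by
    rw [div_lt_iff₀ hs]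
    rw [← div_eq_mul_inv, div_lt_iff₀ hcos] at hs₁
    linarith
  -- Seen from distance at least s, the segment from y to `xs` subtends at most arcsin (R / s);
  -- `hs₁` leaves room for this on top of θ below a right angle.
  have hasin : Real.arcsin (R / s) < Real.pi / 2 - θ := by
    rw [Real.arcsin_lt_iff_lt_sin' ⟨by linarith, by linarith⟩, Real.sin_pi_div_two_sub]
    exact hq1
  have hasin0 : 0 ≤ Real.arcsin (R / s) := Real.arcsin_nonneg.2 hq0
  have hα : 0 < Real.cos (θ + Real.arcsin (R / s)) :=
    Real.cos_pos_of_mem_Ioo ⟨by linarith, by linarith⟩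
  refine ⟨Real.cos (θ + Real.arcsin (R / s)) * (ε / δ), by positivity, fun z hz g hg => ?_⟩
  have hzn : 0 < ‖z - y‖ := hs.trans_le hz
  have hzxs : δ < ‖z - xs‖ := by
    have := norm_sub_le_norm_sub_add_norm_sub z xs y
    linarith
  have hzC : z ∉ sublevelSet f xs ε := fun h => by
    have := hδ.2 h
    rw [mem_closedBall_iff_norm] at this
    linarith
  have hgn := norm_subgradient_ge hf hε hδ hzC hg
  have hxz : xs - z ≠ 0 := by
    rw [← norm_pos_iff, norm_sub_rev]
    linarith
  have hφ : InnerProductGeometry.angle (xs - z) (y - z) ≤ Real.arcsin (R / s) := by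
    have hsin := sin_angle_mul_norm_le (xs - z) (y - z) hxz
    rw [sub_sub_sub_cancel_right, norm_sub_rev y z, ← hR] at hsin
    -- The sine bound controls the angle only once it is known to be acute, which follows from R < s
    -- ≤ ‖z - y‖.
    have hlt : InnerProductGeometry.angle (xs - z) (y - z) < Real.pi / 2 := by
      rw [InnerProductGeometry.angle, Real.arccos_lt_pi_div_two]
      apply div_pos _ (mul_pos (norm_pos_iff.2 hxz) (by rwa [norm_sub_rev]))
      have e : xs - z = (y - z) + (xs - y) := by abel
      have hyz : ‖y - z‖ = ‖z - y‖ := norm_sub_rev _ _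
      rw [e, inner_add_left, real_inner_self_eq_norm_sq, hyz]
      have h1 := neg_le_of_abs_le (abs_real_inner_le_norm (xs - y) (y - z))
      rw [hyz, ← hR] at h1
      nlinarith
    rw [Real.le_arcsin_iff_sin_le' ⟨by
      linarith [InnerProductGeometry.angle_nonneg (xs - z) (y - z), Real.pi_pos], hlt.le⟩]
    rw [le_div_iff₀ hs]
    refine le_trans ?_ hsin
    exact mul_le_mul_of_nonneg_left hz (InnerProductGeometry.sin_angle_nonneg _ _)
  have htot : InnerProductGeometry.angle (-g) (y - z) ≤ θ + Real.arcsin (R / s) :=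
    (InnerProductGeometry.angle_le_angle_add_angle _ (xs - z) _).trans
      (add_le_add (hang z hzC g hg) hφ)
  have hc : Real.cos (θ + Real.arcsin (R / s)) ≤
      Real.cos (InnerProductGeometry.angle (-g) (y - z)) :=
    Real.cos_le_cos_of_nonneg_of_le_pi (InnerProductGeometry.angle_nonneg _ _)
      (by linarith [Real.pi_pos]) htot
  have hi := InnerProductGeometry.cos_angle_mul_norm_mul_norm (-g) (y - z)
  rw [← neg_sub z y, inner_neg_neg, norm_neg, norm_neg] at hi
  rw [← hi, mul_assoc, neg_sub]
  exact mul_le_mul hc (mul_le_mul_of_nonneg_right hgn hzn.le) (by positivity)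
    (hα.le.trans hc)

/-- With ρ = ‖z - y‖, the squared new distance is at most ρ² - 2ηcρ + η²L². For η ≤ cs / L² the
quadratic term costs at most half the gain, leaving ρ² - ηcρ ≤ (ρ - cη / 2)². -/
theorem exists_gradient_step_decrease (hf : ConvexOn ℝ Set.univ f) {ε δ θ : ℝ} (hε : 0 < ε)
    (hδ : IsSublevelRadius f xs ε δ) (hθ : IsAngleBound f xs ε θ) {L : ℝ} (hL : 0 < L)
    (hgrad : ∀ x, ∀ g ∈ subdifferential f x, ‖g‖ ≤ L) (y : Vec d) {s : ℝ}
    (hs₁ : ‖xs - y‖ * (Real.cos θ)⁻¹ < s) (hs₂ : ‖xs - y‖ + δ < s) :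
    ∃ c η₀, 0 < c ∧ 0 < η₀ ∧ ∀ z, s ≤ ‖z - y‖ → ∀ g ∈ subdifferential f z,
      ∀ η, 0 ≤ η → η ≤ η₀ → ‖z - η • g - y‖ ≤ ‖z - y‖ - c * η := by
  obtain ⟨c, hc, hinner⟩ := exists_inner_subgradient_ge hf hε hδ hθ y hs₁ hs₂
  have hs : 0 < s := lt_of_le_of_lt (add_nonneg (norm_nonneg _) hδ.1.le) hs₂
  refine ⟨c / 2, c * s / L ^ 2, by positivity, by positivity, fun z hz g hg η hη hη₀ => ?_⟩
  have h1 := hinner z hz g hg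
  have hgL := hgrad z g hg
  have hρ : 0 < ‖z - y‖ := hs.trans_le hz
  rw [le_div_iff₀ (by positivity)] at hη₀
  have h2 : η * L ^ 2 ≤ c * ‖z - y‖ := hη₀.trans (by gcongr)
  have hcL : c ≤ L := by
    have h3 := h1.trans (real_inner_le_norm _ _)
    exact (le_of_mul_le_mul_right h3 hρ).trans hgL
  have hcc : c ^ 2 ≤ L ^ 2 := by gcongr
  have hgg : ‖g‖ ^ 2 ≤ L ^ 2 := by gcongr
  have h4 : η * c ≤ ‖z - y‖ := by
    have : η * c ^ 2 ≤ c * ‖z - y‖ := (mul_le_mul_of_nonneg_left hcc hη).trans h2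
    nlinarith
  apply abs_le_of_sq_le_sq' _ (by linarith) |>.2
  have e : z - η • g - y = (z - y) - η • g := by abel
  rw [e, @norm_sub_sq_real, norm_smul, inner_smul_right, real_inner_comm,
    Real.norm_of_nonneg hη]
  have h5 : η * (c * ‖z - y‖) ≤ η * inner ℝ g (z - y) := by gcongr
  have h6 : η * (η * L ^ 2) ≤ η * (c * ‖z - y‖) := by gcongr
  have h7 : η ^ 2 * ‖g‖ ^ 2 ≤ η ^ 2 * L ^ 2 := by gcongr
  nlinarith [sq_nonneg (c * η)]

end Convexity

/-! ### Real sequences: summability and descent with summable errors. -/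

section Sequences

/-- Each partial sum is at most the sum of the first T terms plus q times itself. -/
theorem summable_of_contraction {v : ℕ → ℝ} (hv : ∀ k, 0 ≤ v k) {q : ℝ} (hq : q < 1) {T : ℕ}
    (h : ∀ k, v (k + T) ≤ q * v k) : Summable v := by
  refine summable_of_sum_range_le (c := (∑ k ∈ Finset.range T, v k) / (1 - q)) hv fun n => ?_
  rw [le_div_iff₀ (by linarith)]
  have h1 : ∑ k ∈ Finset.range n, v k ≤ ∑ k ∈ Finset.range (T + n), v k :=
    Finset.sum_le_sum_of_subset_of_nonneg (by simp) fun _ _ _ => hv _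
  rw [Finset.sum_range_add] at h1
  have h2 : ∑ k ∈ Finset.range n, v (T + k) ≤ q * ∑ k ∈ Finset.range n, v k := by
    rw [Finset.mul_sum]
    exact Finset.sum_le_sum fun k _ => by rw [add_comm]; exact h k
  linarith

theorem not_summable_step {c₁ c₂ : ℝ} (h₁ : 0 < c₁) (h₂ : 0 < c₂) :
    ¬ Summable fun k : ℕ => c₁ / ((k : ℝ) + c₂) := by
  intro h
  obtain ⟨m, hm⟩ := exists_nat_gt c₂
  have h3 : Summable fun k : ℕ => c₁ * (1 / (((k + m : ℕ) : ℝ))) := by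
    refine h.of_nonneg_of_le (fun k => by positivity) fun k => ?_
    rw [mul_one_div]
    push_cast
    gcongr
  rw [summable_mul_left_iff h₁.ne', summable_nat_add_iff (f := fun k : ℕ => 1 / (k : ℝ))] at h3
  exact Real.not_summable_one_div_natCast h3

theorem tendsto_step (c₁ c₂ : ℝ) :
    Tendsto (fun k : ℕ => c₁ / ((k : ℝ) + c₂)) atTop (𝓝 0) :=
  tendsto_const_nhds.div_atTop (tendsto_atTop_add_const_right _ _ tendsto_natCast_atTop_atTop)

/-- A sequence that decreases by a nonsummable amount, up to a summable error, as long as it is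
above `s`, is eventually at most `s` up to any positive tolerance. -/
theorem eventually_le_of_decrease {D E η : ℕ → ℝ} {s : ℝ} (hE : ∀ k, 0 ≤ E k)
    (hEs : Summable E) (hη : ∀ k, 0 ≤ η k) (hηs : ¬ Summable η) {u : ℕ → ℝ}
    (hu : Tendsto u atTop (𝓝 s)) (hD : ∀ᶠ k in atTop, D (k + 1) ≤ max (u k) (D k + E k - η k))
    {ξ : ℝ} (hξ : 0 < ξ) : ∀ᶠ k in atTop, D k ≤ s + ξ := by
  -- Adding the future errors to D absorbs them: D + tail drops by the full η k whenever the second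
  -- branch of the maximum applies.
  set tail : ℕ → ℝ := fun k => ∑' j, E (j + k) with htail
  have htail0 : ∀ k, 0 ≤ tail k := fun k => tsum_nonneg fun _ => hE _
  have htend : Tendsto tail atTop (𝓝 0) := tendsto_sum_nat_add E
  have hstep : ∀ k, tail k = E k + tail (k + 1) := fun k => by
    have := ((summable_nat_add_iff k).2 hEs).tsum_eq_zero_add
    simp only [htail]
    rw [this, zero_add]
    congr 1
    exact tsum_congr fun j => by congr 1; ring
  have hu' : ∀ᶠ k in atTop, u k < s + ξ / 2 := hu.eventually_lt_const (by linarith)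
  have ht' : ∀ᶠ k in atTop, tail k < ξ / 2 := htend.eventually_lt_const (by linarith)
  obtain ⟨K, hK⟩ := eventually_atTop.1 (hD.and (hu'.and ht'))
  have hP : ∀ k, K ≤ k → D (k + 1) + tail (k + 1) ≤ max (s + ξ) (D k + tail k - η k) := by
    intro k hk
    obtain ⟨h1, h2, -⟩ := hK k hk
    have h3 := (hK (k + 1) (by omega)).2.2
    have h4 := hstep k
    rcases le_max_iff.1 h1 with h | h
    · exact le_max_of_le_left (by linarith)
    · exact le_max_of_le_right (by linarith)
  -- Staying above the level forever would bound the partial sums of η, against `hηs`.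
  have hex : ∃ k, K ≤ k ∧ D k + tail k ≤ s + ξ := by
    by_contra hcon
    push Not at hcon
    have hdec : ∀ n, D (n + K) + tail (n + K) + ∑ j ∈ Finset.range n, η (j + K) ≤
        D K + tail K := by
      intro n
      induction n with
      | zero => simp
      | succ n ih =>
        have h1 := hP (n + K) (by omega)
        have h2 := hcon (n + K + 1) (by omega)
        rcases le_max_iff.1 h1 with h | h
        · linarith
        · rw [Finset.sum_range_succ, show n + 1 + K = n + K + 1 by ring]
          linarith
    refine hηs ((summable_nat_add_iff K).1 (summable_of_sum_range_le
      (c := D K + tail K - (s + ξ)) (fun _ => hη _) fun n => ?_))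
    have := hdec n
    have := hcon (n + K) (by omega)
    linarith
  obtain ⟨k₀, hk₀, hle⟩ := hex
  have hstay : ∀ k, k₀ ≤ k → D k + tail k ≤ s + ξ := by
    intro k hk
    induction k, hk using Nat.le_induction with
    | base => exact hle
    | succ k hk ih =>
      refine (hP k (by omega)).trans (max_le le_rfl ?_)
      linarith [hη k]
  filter_upwards [eventually_ge_atTop k₀] with k hk
  linarith [hstay k hk, htail0 k]

end Sequences

/-! ### What survives trimming. -/

section Filters

variable {V : Type*} [DecidableEq V] {F : ℕ} {i : V} {D A T : Finset V} {a : V → ℝ}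

/-- With at most `F` adversarial values, every value that survives the removal of the `F` largest
ones is bounded by a regular value. -/
theorem IsTopRemoval.exists_regular_ge (hT : IsTopRemoval F i D a T) (hA : (D ∩ A).card ≤ F)
    (hi : i ∈ D) (hiA : i ∉ A) {j : V} (hj : j ∈ D \ T) : ∃ r ∈ D, r ∉ A ∧ a j ≤ a r := by
  obtain ⟨hsub, hcard, hmax⟩ := hT
  rw [Finset.mem_sdiff] at hj
  rcases le_or_gt (a j) (a i) with h | h
  · exact ⟨i, hi, hiA, h⟩
  have hjf : j ∈ D.filter fun j => a i < a j := Finset.mem_filter.2 ⟨hj.1, h⟩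
  have hlt : T.card < (D.filter fun j => a i < a j).card :=
    Finset.card_lt_card ⟨hsub, fun hc => hj.2 (hc hjf)⟩
  -- As j survives above the own value, the removal used its full quota. Were no regular value at
  -- least a j, then j and the F removed nodes would be F + 1 adversaries.
  have hTF : T.card = F := by omega
  by_contra hcon
  push Not at hcon
  have hins : insert j T ⊆ D ∩ A := by
    intro r hr
    have hrD : r ∈ D ∧ a j ≤ a r := by
      rcases Finset.mem_insert.1 hr with rfl | hr
      · exact ⟨hj.1, le_rfl⟩
      · exact ⟨(Finset.mem_filter.1 (hsub hr)).1,
          hmax r hr j (Finset.mem_sdiff.2 ⟨hjf, hj.2⟩)⟩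
    refine Finset.mem_inter.2 ⟨hrD.1, ?_⟩
    by_contra hrA
    exact absurd hrD.2 (not_le.2 (hcon r hrD.1 hrA))
  have := Finset.card_le_card hins
  rw [Finset.card_insert_of_notMem hj.2] at this
  omega

theorem IsTopRemoval.lt_of_mem (hT : IsTopRemoval F i D a T) {j : V} (hj : j ∈ T) : a i < a j :=
  (Finset.mem_filter.1 (hT.1 hj)).2

theorem IsTopRemoval.card_le (hT : IsTopRemoval F i D a T) : T.card ≤ F := by
  have := hT.2.1
  omega

theorem ScalarMinMaxFilter.neg {S : Finset V} (h : ScalarMinMaxFilter F i D a S) :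
    ScalarMinMaxFilter F i D (fun j => -a j) S := by
  obtain ⟨T, B, hT, hB, rfl⟩ := h
  exact ⟨B, T, hB, by simpa [IsBottomRemoval] using hT, by rw [Finset.union_comm]⟩

theorem ScalarMinMaxFilter.self_mem {S : Finset V} (h : ScalarMinMaxFilter F i D a S)
    (hi : i ∈ D) : i ∈ S := by
  obtain ⟨T, B, hT, hB, rfl⟩ := h
  simp only [Finset.mem_sdiff, Finset.mem_union, not_or]
  exact ⟨hi, fun h => lt_irrefl _ (hT.lt_of_mem h),
    fun h => lt_irrefl _ (IsTopRemoval.lt_of_mem hB h)⟩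

end Filters

/-! ### Averages with weights bounded below. -/

section Weights

variable {V : Type*} {ω : ℝ} {S : Finset V} {w : V → ℝ}

theorem IsWeights.le_one (h : IsWeights ω S w) {j : V} (hj : j ∈ S) : ω ≤ 1 :=
  (h.2.1 j ((h.1 j).2 hj).ne').trans <| h.2.2 ▸
    Finset.single_le_sum (fun k hk => ((h.1 k).2 hk).le) hj

/-- An average with weights at least `ω` of values below `M`, one of them at most `c`. -/
theorem IsWeights.sum_le (h : IsWeights ω S w) {a : V → ℝ} {M c : ℝ} (ha : ∀ j ∈ S, a j ≤ M)
    (hc : c ≤ M) {j : V} (hj : j ∈ S) (hjc : a j ≤ c) :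
    ∑ j ∈ S, w j * a j ≤ M - ω * (M - c) := by
  have h0 : ∀ k ∈ S, 0 ≤ w k * (M - a k) := fun k hk =>
    mul_nonneg ((h.1 k).2 hk).le (sub_nonneg.2 (ha k hk))
  have h1 := Finset.single_le_sum h0 hj
  have hw := (h.1 j).2 hj
  have h2 : ω * (M - c) ≤ w j * (M - a j) :=
    mul_le_mul (h.2.1 j hw.ne') (by linarith) (by linarith) hw.le
  have h3 : ∑ k ∈ S, w k * (M - a k) = M - ∑ k ∈ S, w k * a k := by
    simp_rw [mul_sub]
    rw [Finset.sum_sub_distrib, ← Finset.sum_mul, h.2.2, one_mul]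
  linarith

end Weights

/-! ### Resilient scalar consensus by trimmed means. -/

section Consensus

variable {V : Type*} [Fintype V] [DecidableEq V]

theorem card_senders_inter_le {G : Digraph V} {F : ℕ} {A : Finset V} (hA : IsLocalSet G F A)
    {i : V} (hi : i ∉ A) : (senders G i ∩ A).card ≤ F := by
  rw [senders, Finset.insert_inter_of_notMem hi]
  exact hA i hi

/-- The regular nodes repeatedly replace their scalar values by averages from which extreme values
have been trimmed. -/
structure TrimmedMeanDynamics (G : Digraph V) (A : Finset V) (F : ℕ) (ω : ℝ) (a : ℕ → V → ℝ)
    (msg : ℕ → V → V → ℝ) (S : ℕ → V → Finset V) (w : ℕ → V → V → ℝ) : Prop where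
  receive : ∀ k i, i ∉ A → ∀ j ∈ senders G i, j ∉ A → msg k i j = a k j
  filter : ∀ k i, i ∉ A → ScalarMinMaxFilter F i (senders G i) (msg k i) (S k i)
  weights : ∀ k i, i ∉ A → IsWeights ω (S k i) (w k i)
  average : ∀ k i, i ∉ A → a (k + 1) i = ∑ j ∈ S k i, w k i j * msg k i j

namespace TrimmedMeanDynamics

variable {G : Digraph V} {A : Finset V} {F : ℕ} {ω : ℝ} {a : ℕ → V → ℝ}
  {msg : ℕ → V → V → ℝ} {S : ℕ → V → Finset V} {w : ℕ → V → V → ℝ}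

/-- Negation swaps the two trimmings, so every upper bound below also yields a lower bound. -/
theorem neg (h : TrimmedMeanDynamics G A F ω a msg S w) :
    TrimmedMeanDynamics G A F ω (fun k i => -a k i) (fun k i j => -msg k i j) S w where
  receive k i hi j hj hjA := by rw [h.receive k i hi j hj hjA]
  filter k i hi := (h.filter k i hi).neg
  weights := h.weights
  average k i hi := by simp [h.average k i hi]

theorem self_mem (h : TrimmedMeanDynamics G A F ω a msg S w) (k : ℕ) {i : V} (hi : i ∉ A) :
    i ∈ S k i :=
  (h.filter k i hi).self_mem (Finset.mem_insert_self _ _)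

theorem msg_self (h : TrimmedMeanDynamics G A F ω a msg S w) (k : ℕ) {i : V} (hi : i ∉ A) :
    msg k i i = a k i :=
  h.receive k i hi i (Finset.mem_insert_self _ _) hi

theorem msg_le (h : TrimmedMeanDynamics G A F ω a msg S w) (hA : IsLocalSet G F A) {k : ℕ}
    {M : ℝ} (hM : ∀ r, r ∉ A → a k r ≤ M) {i : V} (hi : i ∉ A) {j : V} (hj : j ∈ S k i) :
    msg k i j ≤ M := by
  obtain ⟨T, B, hT, -, hS⟩ := h.filter k i hi
  rw [hS, Finset.mem_sdiff, Finset.mem_union, not_or] at hj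
  obtain ⟨r, hr, hrA, hle⟩ := hT.exists_regular_ge (card_senders_inter_le hA hi)
    (Finset.mem_insert_self _ _) hi (Finset.mem_sdiff.2 ⟨hj.1, hj.2.1⟩)
  rw [h.receive k i hi r hr hrA] at hle
  exact hle.trans (hM r hrA)

/-- A node never trims its own value, which therefore enters the average with weight at least ω. -/
theorem next_le_of_le (h : TrimmedMeanDynamics G A F ω a msg S w) (hA : IsLocalSet G F A)
    {k : ℕ} {M ε : ℝ} (hε : 0 ≤ ε) (hM : ∀ r, r ∉ A → a k r ≤ M) {i : V} (hi : i ∉ A)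
    (hai : a k i ≤ M - ε) : a (k + 1) i ≤ M - ω * ε := by
  rw [h.average k i hi]
  have := (h.weights k i hi).sum_le (c := M - ε) (fun j hj => h.msg_le hA hM hi hj)
    (by linarith) (h.self_mem k hi) (by rwa [h.msg_self k hi])
  linarith

theorem next_le (h : TrimmedMeanDynamics G A F ω a msg S w) (hA : IsLocalSet G F A)
    {k : ℕ} {M : ℝ} (hM : ∀ r, r ∉ A → a k r ≤ M) {i : V} (hi : i ∉ A) : a (k + 1) i ≤ M := by
  have := h.next_le_of_le hA le_rfl hM hi (by simpa using hM i hi)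
  simpa using this

/-- A node above the level `M - ε` with `2F + 1` in-neighbours outside a set that contains all
regular nodes above that level uses one of the values below it. -/
theorem next_le_of_reachable (h : TrimmedMeanDynamics G A F ω a msg S w)
    (hA : IsLocalSet G F A) {k : ℕ} {M ε : ℝ} (hε : 0 ≤ ε) (hM : ∀ r, r ∉ A → a k r ≤ M)
    {U : Finset V} (hU : ∀ r, r ∉ A → r ∉ U → a k r ≤ M - ε) {i : V} (hi : i ∉ A)
    (hai : M - ε < a k i) (hreach : 2 * F + 1 ≤ (inNeighbors G i \ U).card) :
    a (k + 1) i ≤ M - ω * ε := by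
  obtain ⟨T, B, hT, hB, hS⟩ := h.filter k i hi
  -- Of the 2F + 1 in-neighbours at most F are adversarial, and bottom trimming removes at most F of
  -- the rest. The survivor u lies below the own value, so top trimming spares it.
  have hcard : F + 1 ≤ ((inNeighbors G i \ U) \ A).card := by
    have h1 := Finset.card_sdiff_add_card_inter (inNeighbors G i \ U) A
    have h2 : ((inNeighbors G i \ U) ∩ A).card ≤ (inNeighbors G i ∩ A).card :=
      Finset.card_le_card (Finset.inter_subset_inter_right Finset.sdiff_subset)
    have h3 := hA i hi
    omega
  obtain ⟨u, hu, huB⟩ : ∃ u ∈ (inNeighbors G i \ U) \ A, u ∉ B := by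
    by_contra hcon
    push Not at hcon
    have h1 := Finset.card_le_card (show (inNeighbors G i \ U) \ A ⊆ B from hcon)
    have h2 := IsTopRemoval.card_le hB
    omega
  simp only [Finset.mem_sdiff] at hu
  have hus : u ∈ senders G i := Finset.mem_insert_of_mem hu.1.1
  have huval : msg k i u ≤ M - ε := by
    rw [h.receive k i hi u hus hu.2]
    exact hU u hu.2 hu.1.2
  have huT : u ∉ T := fun hmem => by
    have := hT.lt_of_mem hmem
    rw [h.msg_self k hi] at this
    linarith
  have huS : u ∈ S k i := by
    rw [hS]
    simp [hus, huT, huB]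
  rw [h.average k i hi]
  have := (h.weights k i hi).sum_le (c := M - ε) (fun j hj => h.msg_le hA hM hi hj)
    (by linarith) huS huval
  linarith

/-- The regular nodes with value above `c`. -/
noncomputable def above (A : Finset V) (a : V → ℝ) (c : ℝ) : Finset V :=
  Aᶜ.filter fun i => c < a i

theorem above_next_subset (h : TrimmedMeanDynamics G A F ω a msg S w) (hA : IsLocalSet G F A)
    {k : ℕ} {M ε : ℝ} (hε : 0 ≤ ε) (hM : ∀ r, r ∉ A → a k r ≤ M) :
    above A (a (k + 1)) (M - ω * ε) ⊆ above A (a k) (M - ε) := by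
  intro i hi
  simp only [above, Finset.mem_filter, Finset.mem_compl] at hi ⊢
  refine ⟨hi.1, ?_⟩
  by_contra hcon
  exact absurd (h.next_le_of_le hA hε hM hi.1 (not_lt.1 hcon)) (not_le.2 hi.2)

theorem card_above_next_lt (h : TrimmedMeanDynamics G A F ω a msg S w) (hA : IsLocalSet G F A)
    {k : ℕ} {M ε : ℝ} (hε : 0 ≤ ε) (hM : ∀ r, r ∉ A → a k r ≤ M)
    (hreach : IsReachable G (2 * F + 1) (above A (a k) (M - ε))) :
    (above A (a (k + 1)) (M - ω * ε)).card < (above A (a k) (M - ε)).card := by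
  obtain ⟨i, hi, hcard⟩ := hreach
  refine Finset.card_lt_card ⟨h.above_next_subset hA hε hM, fun hcon => ?_⟩
  have hi' := hcon hi
  simp only [above, Finset.mem_filter, Finset.mem_compl] at hi hi'
  refine absurd (h.next_le_of_reachable hA hε hM (fun r hr hrU => ?_) hi.1 hi.2 hcard)
    (not_le.2 hi'.2)
  simp only [above, Finset.mem_filter, Finset.mem_compl, not_and, not_lt] at hrU
  exact hrU hr

/-- Within as many steps as there are regular nodes, either the upper or the lower end of the range
of the regular values is left by a definite fraction. -/
theorem contraction (h : TrimmedMeanDynamics G A F ω a msg S w) (hA : IsLocalSet G F A)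
    (hG : IsRobust G (2 * F + 1)) (hω : 0 < ω) (hω1 : ω ≤ 1) {k : ℕ} {m M : ℝ} (hmM : m ≤ M)
    (hM : ∀ r, r ∉ A → a k r ≤ M) (hm : ∀ r, r ∉ A → m ≤ a k r) :
    (∀ r, r ∉ A → a (k + Aᶜ.card) r ≤ M - ω ^ Aᶜ.card * ((M - m) / 2)) ∨
      ∀ r, r ∉ A → m + ω ^ Aᶜ.card * ((M - m) / 2) ≤ a (k + Aᶜ.card) r := by
  -- The margin shrinks by ω per step so that a node once out of the extreme set stays out. It never
  -- exceeds half the range, which keeps the upper set U and the lower set W disjoint.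
  set e : ℕ → ℝ := fun t => ω ^ t * ((M - m) / 2) with he
  have he0 : ∀ t, 0 ≤ e t := fun t => mul_nonneg (by positivity) (by linarith)
  have he1 : ∀ t, e t ≤ (M - m) / 2 := fun t =>
    mul_le_of_le_one_left (by linarith) (pow_le_one₀ hω.le hω1)
  have hes : ∀ t, e (t + 1) = ω * e t := fun t => by simp only [he]; ring
  set U : ℕ → Finset V := fun t => above A (a (k + t)) (M - e t) with hU
  set W : ℕ → Finset V := fun t => above A (fun i => -a (k + t) i) (-m - e t) with hW
  have hMt : ∀ t r, r ∉ A → a (k + t) r ≤ M := by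
    intro t
    induction t with
    | zero => exact hM
    | succ t ih => exact fun r hr => h.next_le hA ih hr
  have hmt : ∀ t r, r ∉ A → -a (k + t) r ≤ -m := by
    intro t
    induction t with
    | zero => exact fun r hr => neg_le_neg (hm r hr)
    | succ t ih => exact fun r hr => h.neg.next_le hA ih hr
  have hUs : ∀ t, U (t + 1) ⊆ U t := fun t => by
    simp only [hU, hes]
    exact h.above_next_subset hA (he0 t) (hMt t)
  have hWs : ∀ t, W (t + 1) ⊆ W t := fun t => by
    simp only [hW, hes]
    exact h.neg.above_next_subset hA (he0 t) (hmt t)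
  have hdisj : ∀ t, Disjoint (U t) (W t) := fun t => by
    rw [Finset.disjoint_left]
    intro i hi hi'
    simp only [hU, hW, above, Finset.mem_filter] at hi hi'
    linarith [he1 t]
  -- While both sets are nonempty, robustness makes one of them lose a node at each step.
  have key : ∀ t, U t = ∅ ∨ W t = ∅ ∨ (U t).card + (W t).card + t ≤ Aᶜ.card := by
    intro t
    induction t with
    | zero =>
      refine Or.inr (Or.inr ?_)
      rw [add_zero, ← Finset.card_union_of_disjoint (hdisj 0)]
      refine Finset.card_le_card (Finset.union_subset ?_ ?_) <;> exact Finset.filter_subset _ _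
    | succ t ih =>
      rcases (U t).eq_empty_or_nonempty with hu | hu
      · exact Or.inl (Finset.subset_empty.1 (hu ▸ hUs t))
      rcases (W t).eq_empty_or_nonempty with hw | hw
      · exact Or.inr (Or.inl (Finset.subset_empty.1 (hw ▸ hWs t)))
      have hsum := (ih.resolve_left hu.ne_empty).resolve_left hw.ne_empty
      refine Or.inr (Or.inr ?_)
      have hu' := Finset.card_le_card (hUs t)
      have hw' := Finset.card_le_card (hWs t)
      rcases hG _ _ hu hw (hdisj t) with hr | hr
      · have : (U (t + 1)).card < (U t).card := by
          have := h.card_above_next_lt hA (he0 t) (hMt t) hr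
          rwa [← hes] at this
        omega
      · have : (W (t + 1)).card < (W t).card := by
          have := h.neg.card_above_next_lt hA (he0 t) (hmt t) hr
          rwa [← hes] at this
        omega
  have hend : U Aᶜ.card = ∅ ∨ W Aᶜ.card = ∅ := by
    rcases key Aᶜ.card with h | h | h
    · exact Or.inl h
    · exact Or.inr h
    · exact Or.inl (Finset.card_eq_zero.1 (by omega))
  refine hend.imp (fun h0 r hr => ?_) fun h0 r hr => ?_
  · by_contra hcon
    have : r ∈ U Aᶜ.card := by simpa [hU, above, hr] using not_le.1 hcon
    simp [h0] at this
  · by_contra hcon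
    have : r ∈ W Aᶜ.card := by
      simp only [hW, above, Finset.mem_filter, Finset.mem_compl]
      refine ⟨hr, ?_⟩
      simp only [he]
      linarith [not_le.1 hcon]
    simp [h0] at this

/-- Resilient consensus: the regular values have a common limit, with summable deviations. -/
theorem exists_limit (h : TrimmedMeanDynamics G A F ω a msg S w) (hA : IsLocalSet G F A)
    (hG : IsRobust G (2 * F + 1)) (hω : 0 < ω) :
    ∃ y : ℝ, ∀ i, i ∉ A → Summable fun k => |a k i - y| := by
  rcases Aᶜ.eq_empty_or_nonempty with hne | hne
  · refine ⟨0, fun i hi => ?_⟩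
    have : i ∈ Aᶜ := Finset.mem_compl.2 hi
    simp [hne] at this
  obtain ⟨i₀, hi₀⟩ := id hne
  rw [Finset.mem_compl] at hi₀
  have hω1 : ω ≤ 1 := (h.weights 0 i₀ hi₀).le_one (h.self_mem 0 hi₀)
  set M : ℕ → ℝ := fun k => Aᶜ.sup' hne (a k) with hMdef
  set m : ℕ → ℝ := fun k => Aᶜ.inf' hne (a k) with hmdef
  have hM : ∀ k r, r ∉ A → a k r ≤ M k := fun k r hr =>
    Finset.le_sup' (a k) (Finset.mem_compl.2 hr)
  have hm : ∀ k r, r ∉ A → m k ≤ a k r := fun k r hr =>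
    Finset.inf'_le (a k) (Finset.mem_compl.2 hr)
  have hMle : ∀ k c, (∀ r, r ∉ A → a k r ≤ c) → M k ≤ c := fun k c hc =>
    Finset.sup'_le _ _ fun r hr => hc r (Finset.mem_compl.1 hr)
  have hmle : ∀ k c, (∀ r, r ∉ A → c ≤ a k r) → c ≤ m k := fun k c hc =>
    Finset.le_inf' _ _ fun r hr => hc r (Finset.mem_compl.1 hr)
  have hmM : ∀ k, m k ≤ M k := fun k => (hm k i₀ hi₀).trans (hM k i₀ hi₀)
  have hMa : Antitone M := antitone_nat_of_succ_le fun k =>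
    hMle _ _ fun r hr => h.next_le hA (hM k) hr
  have hmm : Monotone m := monotone_nat_of_le_succ fun k => hmle _ _ fun r hr => by
    have := h.neg.next_le hA (M := -m k) (fun r hr => neg_le_neg (hm k r hr)) hr
    linarith
  have hcross : ∀ j k, m j ≤ M k := fun j k =>
    (hmm (le_max_left j k)).trans ((hmM _).trans (hMa (le_max_right j k)))
  have hsum : Summable fun k => M k - m k := by
    -- One end moves inwards by ω ^ |R| / 2 times the range, and monotonicity keeps the other from
    -- moving outwards.
    refine summable_of_contraction (q := 1 - ω ^ Aᶜ.card / 2) (T := Aᶜ.card)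
      (fun k => sub_nonneg.2 (hmM k)) (by have := pow_pos hω Aᶜ.card; linarith) fun k => ?_
    rcases h.contraction hA hG hω hω1 (hmM k) (hM k) (hm k) with h1 | h1
    · have h2 := hMle _ _ h1
      have h3 := hmm (show k ≤ k + Aᶜ.card by omega)
      linarith
    · have h2 := hmle _ _ h1
      have h3 := hMa (show k ≤ k + Aᶜ.card by omega)
      linarith
  have hbdd : BddBelow (Set.range M) := ⟨m 0, by rintro _ ⟨k, rfl⟩; exact hcross 0 k⟩
  refine ⟨⨅ k, M k, fun i hi => hsum.of_nonneg_of_le (fun _ => abs_nonneg _) fun k => ?_⟩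
  have h1 := ciInf_le hbdd k
  have h2 : m k ≤ ⨅ k, M k := le_ciInf (hcross k)
  have h3 := hM k i hi
  have h4 := hm k i hi
  rw [abs_le]
  constructor <;> linarith

end TrimmedMeanDynamics

end Consensus

/-! ### From the algorithms to the asymptotic bound. -/

section Execution

variable {V : Type*} [Fintype V] [DecidableEq V] {d : ℕ} {alg : Alg} {G : Digraph V}
  {A : Finset V} {F : ℕ} {f : V → Vec d → ℝ} {xhat : V → Vec d} {η : ℕ → ℝ} {ω : ℝ}
  {e : Execution V d}

theorem IsRobust.mono {r r' : ℕ} (h : IsRobust G r) (hr : r' ≤ r) : IsRobust G r' := by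
  intro S₁ S₂ h₁ h₂ hd
  refine (h S₁ S₂ h₁ h₂ hd).imp ?_ ?_ <;>
  · rintro ⟨i, hi, hc⟩
    exact ⟨i, hi, hr.trans hc⟩

theorem Follows.trimmedMeanDynamics (he : Follows alg G A F f xhat η ω e) (l : Fin d) :
    TrimmedMeanDynamics G A F ω (fun k i => e.y k i l) (fun k i j => e.ymsg k i j l)
      (fun k i => e.yKept k i l) (fun k i j => e.wy k i l j) where
  receive k i hi j hj hjA := by simp only [(he.step k i hi).receive_y j hj hjA]
  filter k i hi := (he.step k i hi).aux_filter l
  weights k i hi := (he.step k i hi).y_weights l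
  average k i hi := (he.step k i hi).y_average l

theorem norm_le_sum_abs (v : Vec d) : ‖v‖ ≤ ∑ l, |v l| := by
  have h : v = ∑ l, EuclideanSpace.single l (v l) := by
    ext m
    simp [Finset.sum_apply, Pi.single_apply]
  calc ‖v‖ = ‖∑ l, EuclideanSpace.single l (v l)‖ := by rw [← h]
    _ ≤ ∑ l, ‖EuclideanSpace.single l (v l)‖ := norm_sum_le _ _
    _ = ∑ l, |v l| := by simp

/-- Robustness is required only in the presence of a coordinate: for d = 0 the assumption on
Algorithm 1 gives just F + 1. -/
theorem Follows.exists_aux_limit (he : Follows alg G A F f xhat η ω e) (hA : IsLocalSet G F A)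
    (hG : Fin d → IsRobust G (2 * F + 1)) (hω : 0 < ω) :
    ∃ y : Vec d, ∀ i, i ∉ A → Summable fun k => ‖e.y k i - y‖ := by
  choose y hy using fun l => (he.trimmedMeanDynamics l).exists_limit hA (hG l) hω
  refine ⟨WithLp.toLp 2 y, fun i hi => ?_⟩
  refine (summable_sum fun l (_ : l ∈ Finset.univ) => hy l i hi).of_nonneg_of_le
    (fun _ => norm_nonneg _) fun k => (norm_le_sum_abs _).trans (le_of_eq ?_)
  simp

theorem RegularStep.kept_subset {k : ℕ} {i : V} (h : RegularStep alg G A F f η ω e k i) :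
    e.kept k i ⊆ e.distKept k i := by
  have h' := h.state_filter
  cases alg with
  | distMinMax =>
    obtain ⟨T, B, -, -, hS⟩ := h'
    rw [hS]
    exact Finset.sdiff_subset
  | distOnly => exact (show e.kept k i = e.distKept k i from h').subset

/-- The intermediate state is no farther from the limit of the auxiliary points than the regular
states are, up to the error of the own auxiliary point. -/
theorem RegularStep.norm_z_sub_le {k : ℕ} {i : V} (h : RegularStep alg G A F f η ω e k i)
    (hA : IsLocalSet G F A) (hi : i ∉ A) {y : Vec d} {D : ℝ}
    (hD : ∀ r, r ∉ A → ‖e.x k r - y‖ ≤ D) : ‖e.z k i - y‖ ≤ D + 2 * ‖e.y k i - y‖ := by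
  obtain ⟨T, hT, hdist⟩ := h.dist_filter
  have hmsg : ∀ j ∈ e.kept k i, ‖e.xmsg k i j - y‖ ≤ D + 2 * ‖e.y k i - y‖ := by
    intro j hj
    obtain ⟨r, hr, hrA, hle⟩ := hT.exists_regular_ge (card_senders_inter_le hA hi)
      (Finset.mem_insert_self _ _) hi (hdist ▸ h.kept_subset hj)
    rw [h.receive_x r hr hrA] at hle
    -- The filter compares distances to y_i; passing from y to y_i and back costs ‖y_i - y‖ twice.
    have h1 := norm_sub_le_norm_sub_add_norm_sub (e.xmsg k i j) (e.y k i) y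
    have h2 := norm_sub_le_norm_sub_add_norm_sub (e.x k r) y (e.y k i)
    rw [norm_sub_rev y] at h2
    linarith [hD r hrA]
  have hw := h.x_weights
  have hz : e.z k i - y = ∑ j ∈ e.kept k i, e.wx k i j • (e.xmsg k i j - y) := by
    simp_rw [smul_sub]
    rw [Finset.sum_sub_distrib, ← Finset.sum_smul, hw.2.2, one_smul, ← h.x_average]
  rw [hz]
  calc _ ≤ ∑ j ∈ e.kept k i, ‖e.wx k i j • (e.xmsg k i j - y)‖ := norm_sum_le _ _
    _ ≤ ∑ j ∈ e.kept k i, e.wx k i j * (D + 2 * ‖e.y k i - y‖) := by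
        refine Finset.sum_le_sum fun j hj => ?_
        have hpos := ((hw.1 j).2 hj).le
        rw [norm_smul, Real.norm_of_nonneg hpos]
        exact mul_le_mul_of_nonneg_left (hmsg j hj) hpos
    _ = _ := by rw [← Finset.sum_mul, hw.2.2, one_mul]

theorem Follows.eventually_norm_x_sub_le (he : Follows alg G A F f xhat η ω e)
    (hA : IsLocalSet G F A) (hne : Aᶜ.Nonempty) (hconv : ∀ i, ConvexOn ℝ Set.univ (f i)) {L : ℝ}
    (hL : 0 < L) (hgrad : ∀ i x, ∀ g ∈ subdifferential (f i) x, ‖g‖ ≤ L) (hη : ∀ k, 0 ≤ η k)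
    (hηs : ¬ Summable η) (hη0 : Tendsto η atTop (𝓝 0)) {y : Vec d}
    (hy : ∀ i, i ∉ A → Summable fun k => ‖e.y k i - y‖) {xstar : V → Vec d} {ε : ℝ}
    (hε : 0 < ε) {δ θ : V → ℝ} (hδ : ∀ i, i ∉ A → IsSublevelRadius (f i) (xstar i) ε (δ i))
    (hθ : ∀ i, i ∉ A → IsAngleBound (f i) (xstar i) ε (θ i)) {s : ℝ}
    (hs : ∀ i, i ∉ A → max (‖xstar i - y‖ * (Real.cos (θ i))⁻¹) (‖xstar i - y‖ + δ i) < s)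
    {ξ : ℝ} (hξ : 0 < ξ) :
    ∀ᶠ k in atTop, ∀ i, i ∉ A → ‖e.x k i - y‖ ≤ s + ξ := by
  have hstep : ∀ i ∈ Aᶜ, ∃ c η₀, 0 < c ∧ 0 < η₀ ∧ ∀ z, s ≤ ‖z - y‖ →
      ∀ g ∈ subdifferential (f i) z, ∀ η, 0 ≤ η → η ≤ η₀ → ‖z - η • g - y‖ ≤ ‖z - y‖ - c * η :=
    fun i hi => by
      have hi := Finset.mem_compl.1 hi
      exact exists_gradient_step_decrease (hconv i) hε (hδ i hi) (hθ i hi) hL (hgrad i) y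
        ((le_max_left _ _).trans_lt (hs i hi)) ((le_max_right _ _).trans_lt (hs i hi))
  choose! c η₀ hc hη₀ hdec using hstep
  set D : ℕ → ℝ := fun k => Aᶜ.sup' hne fun i => ‖e.x k i - y‖ with hDdef
  have hD : ∀ k r, r ∉ A → ‖e.x k r - y‖ ≤ D k := fun k r hr =>
    Finset.le_sup' (fun i => ‖e.x k i - y‖) (Finset.mem_compl.2 hr)
  set E : ℕ → ℝ := fun k => ∑ i ∈ Aᶜ, 2 * ‖e.y k i - y‖ with hEdef
  have hE0 : ∀ k, 0 ≤ E k := fun k => Finset.sum_nonneg fun _ _ => by positivity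
  have hE : Summable E :=
    summable_sum fun i hi => (hy i (Finset.mem_compl.1 hi)).mul_left 2
  set c' : ℝ := Aᶜ.inf' hne c with hc'def
  have hc' : 0 < c' := (Finset.lt_inf'_iff hne).2 hc
  have hsmall : ∀ᶠ k in atTop, η k < Aᶜ.inf' hne η₀ :=
    hη0.eventually_lt_const ((Finset.lt_inf'_iff hne).2 hη₀)
  have hev := eventually_le_of_decrease (D := D) (E := E) (η := fun k => c' * η k)
    -- The level s + η k * L covers nodes whose intermediate state is closer than s, where the step
    -- may point outwards.
    (u := fun k => s + η k * L) (s := s) hE0 hE (fun k => mul_nonneg hc'.le (hη k))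
    (by rwa [summable_mul_left_iff hc'.ne'])
    (by simpa using tendsto_const_nhds.add (hη0.mul_const L)) ?_ hξ
  · filter_upwards [hev] with k hk i hi
    exact (hD k i hi).trans hk
  · filter_upwards [hsmall] with k hk
    refine Finset.sup'_le _ _ fun i hiA => ?_
    have hi := Finset.mem_compl.1 hiA
    have hst := he.step k i hi
    have hz := hst.norm_z_sub_le hA hi (hD k)
    have hyE : 2 * ‖e.y k i - y‖ ≤ E k :=
      Finset.single_le_sum (f := fun i => 2 * ‖e.y k i - y‖) (fun _ _ => by positivity) hiA
    rw [hst.gradient_update]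
    rcases le_or_gt s ‖e.z k i - y‖ with hzs | hzs
    · refine le_max_of_le_right ?_
      have h1 := hdec i hiA _ hzs _ hst.subgradient (η k) (hη k)
        (hk.le.trans (Finset.inf'_le _ hiA))
      have h2 : c' * η k ≤ c i * η k :=
        mul_le_mul_of_nonneg_right (Finset.inf'_le _ hiA) (hη k)
      linarith
    · refine le_max_of_le_left ?_
      have e1 : e.z k i - η k • e.g k i - y = (e.z k i - y) - η k • e.g k i := by abel
      have h1 : ‖η k • e.g k i‖ ≤ η k * L := by
        rw [norm_smul, Real.norm_of_nonneg (hη k)]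
        exact mul_le_mul_of_nonneg_left (hgrad i _ _ hst.subgradient) (hη k)
      rw [e1]
      linarith [norm_sub_le (e.z k i - y) (η k • e.g k i)]

end Execution

end ResilientOpt

/-! ### The convergence theorem. -/

theorem theorem2 {V : Type*} [Fintype V] [DecidableEq V] {d : ℕ}
    (alg : ResilientOpt.Alg) (G : Digraph V) (A : Finset V) (F : ℕ) (hF : 0 < F)
    (f : V → ResilientOpt.Vec d → ℝ) (xstar xhat : V → ResilientOpt.Vec d)
    -- convex local functions with nonempty bounded sets of minimizers
    (hconv : ∀ i, ConvexOn ℝ Set.univ (f i))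
    (hargmin : ∀ i, (ResilientOpt.argminSet (f i)).Nonempty ∧
      Bornology.IsBounded (ResilientOpt.argminSet (f i)))
    (hxstar : ∀ i, xstar i ∈ ResilientOpt.argminSet (f i))
    -- bounded subgradients
    (hgrad : ∃ L : ℝ, 0 < L ∧
      ∀ i x, ∀ g ∈ ResilientOpt.subdifferential (f i) x, ‖g‖ ≤ L)
    -- the regular nodes start from approximate minimizers
    (hxhat : ∃ εstar : ℝ, 0 ≤ εstar ∧ ∀ i, i ∉ A → ‖xhat i - xstar i‖ ≤ εstar)
    -- step size
    (η : ℕ → ℝ) (hη : ∃ c₁ c₂ : ℝ, 0 < c₁ ∧ 0 < c₂ ∧ ∀ k : ℕ, η k = c₁ / ((k : ℝ) + c₂))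
    -- the Byzantine nodes form an `F`-local set
    (hA : ResilientOpt.IsLocalSet G F A)
    -- lower bound for the nonzero weights
    (ω : ℝ) (hω : 0 < ω)
    -- robustness of the network
    (hG₁ : alg = ResilientOpt.Alg.distMinMax → ResilientOpt.IsRobust G ((2 * d + 1) * F + 1))
    (hG₂ : alg = ResilientOpt.Alg.distOnly → ResilientOpt.IsRobust G (2 * F + 1))
    -- an execution with arbitrary behaviour of the Byzantine nodes
    (e : ResilientOpt.Execution V d)
    (he : ResilientOpt.Follows alg G A F f xhat η ω e) :
    -- the radii `δ_i(ε)` and the angles `θ_i(ε)` exist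
    (∀ i, i ∉ A → ∀ ε : ℝ, 0 < ε →
      (∃ δ, ResilientOpt.IsSublevelRadius (f i) (xstar i) ε δ) ∧
      (∃ θ, ResilientOpt.IsAngleBound (f i) (xstar i) ε θ)) ∧
    -- the auxiliary points have a common limit `y[∞]`, and for every choice of `δ` and `θ`
    -- the states of the regular nodes satisfy the asymptotic bound
    ∃ yinf : ResilientOpt.Vec d,
      (∀ i, i ∉ A → Tendsto (fun k => e.y k i) atTop (𝓝 yinf)) ∧
      ∀ δ θ : V → ℝ → ℝ,
        (∀ i, i ∉ A → ∀ ε : ℝ, 0 < ε →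
          ResilientOpt.IsSublevelRadius (f i) (xstar i) ε (δ i ε) ∧
          ResilientOpt.IsAngleBound (f i) (xstar i) ε (θ i ε)) →
        ∀ i (hi : i ∉ A),
          limsup (fun k => ((‖e.x k i - yinf‖ : ℝ) : EReal)) atTop ≤
            ⨅ ε : {ε : ℝ // 0 < ε},
              ((ResilientOpt.convRadius A ⟨i, Finset.mem_compl.mpr hi⟩ xstar yinf θ δ 0 ε : ℝ) :
                EReal) := by
  obtain ⟨L, hL, hgrad⟩ := hgrad
  obtain ⟨c₁, c₂, hc₁, hc₂, hηk⟩ := hη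
  obtain rfl : η = fun k : ℕ => c₁ / ((k : ℝ) + c₂) := funext hηk
  refine ⟨fun i _ ε hε => ?_, ?_⟩
  · obtain ⟨δ, hδ⟩ :=
      ResilientOpt.exists_isSublevelRadius (hconv i) (hargmin i).2 (hxstar i) ε
    exact ⟨⟨δ, hδ⟩, ResilientOpt.exists_isAngleBound (hconv i) hε hδ hL (hgrad i)⟩
  have hG : Fin d → ResilientOpt.IsRobust G (2 * F + 1) := fun l => by
    cases alg with
    | distMinMax =>
      refine (hG₁ rfl).mono (Nat.succ_le_succ (Nat.mul_le_mul_right F ?_))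
      have := l.pos
      omega
    | distOnly => exact hG₂ rfl
  obtain ⟨y, hy⟩ := he.exists_aux_limit hA hG hω
  refine ⟨y, fun i hi => tendsto_iff_norm_sub_tendsto_zero.2 (hy i hi).tendsto_atTop_zero,
    fun δ θ hδθ i hi => le_iInf fun ⟨ε, hε⟩ => ?_⟩
  have hne : Aᶜ.Nonempty := ⟨i, Finset.mem_compl.mpr hi⟩
  refine EReal.le_of_forall_lt_iff_le.1 fun s hs => ?_
  -- The gap above the radius is split: s' exceeds it strictly, as the descent requires, and s - s'
  -- serves as the tolerance ξ.
  obtain ⟨s', hs', hss'⟩ := exists_between (EReal.coe_lt_coe_iff.1 hs)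
  have hmax := (Finset.sup'_lt_iff hne).1 ((add_zero _).symm.trans_lt hs')
  refine limsup_le_of_le (by isBoundedDefault) ?_
  filter_upwards [he.eventually_norm_x_sub_le hA hne hconv hL hgrad (fun k => by positivity)
    (ResilientOpt.not_summable_step hc₁ hc₂) (ResilientOpt.tendsto_step c₁ c₂) hy hε
    (δ := fun r => δ r ε) (θ := fun r => θ r ε) (fun r hr => (hδθ r hr ε hε).1)
    (fun r hr => (hδθ r hr ε hε).2) (fun r hr => hmax r (Finset.mem_compl.2 hr))
    (sub_pos.2 hss')] with k hk
  have := hk i hi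
  rw [add_sub_cancel] at this
  exact EReal.coe_le_coe_iff.2 this
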